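/- Let $f=\frac1n\sum_{i=1}^n f_i$ with $f_i:\mathbb R^{d_1}\times\mathbb R^{d_2}\to\mathbb R$ differentiable, and let $F_i=(\nabla_x f_i,-\nabla_y f_i)$ and $F=\frac1n\sum_i F_i=(\nabla_x f,-\nabla_y f)$ be the saddle gradient operators. Suppose that (i) each $F_i$ is $L$-Lipschitz and differentiable, and its derivative $DF_i$ is $M$-Lipschitz (in operator norm); (ii) $F$ is $\mu$-strongly monotone with $\mu>0$: $\langle Fz-Fw,z-w\rangle\ge\mu\|z-w\|^2$ for all $z,w$. SEG-FFA with stepsizes $\alpha_k,\beta_k$, started at $z_0^0$, runs as follows. In epoch $k=0,1,\dots$ draw a permutation $\tau_k$ of $\{1,\dots,n\}$ uniformly at random, independently of the other epochs. For $i=0,\dots,2n-1$ let $j=\tau_k(i+1)$ if $i<n$ and $j=\tau_k(2n-i)$ if $i\ge n$, and put $$w_i^k=z_i^k-\alpha_k F_j z_i^k,\qquad z_{i+1}^k=z_i^k-\beta_k F_j w_i^k .$$ Finally put $z_0^{k+1}=\frac12(z_0^k+z_{2n}^k)$. Then $f$ has exactly one saddle point $z^*=(x^*,y^*)$, that is,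 a point with $f(x^*,y)\le f(x^*,y^*)\le f(x,y^*)$ for all $x,y$. Moreover, for all $\mu>0$ and $L,M,\sigma,D\ge0$ there are constants $c,C>0$, depending only on $\mu,L,M,\sigma,D$, such that for all $n\ge1$ and $K\ge1$ there is a stepsize $\eta>0$, depending only on $\mu,L,M,\sigma,D,n,K$, with the following property. For all $d_1,d_2$, all $f_1,\dots,f_n$ satisfying (i) and (ii), and every $z_0^0$, if $\|z_0^0-z^*\|\le D$ and $\frac1n\sum_{i=1}^n\|F_iz^*\|^2\le\sigma^2$, then SEG-FFA with the constant stepsizes $\beta_k=\eta$, $\alpha_k=\eta/2$ satisfies, with $\omega=c/n$, $$\mathbb E\|z_0^K-z^*\|^2\le\exp\!\left(-\tfrac12\mu\,\omega\,nK\right)\|z_0^0-z^*\|^2+C\,\frac{\bigl(\log(n^{1/4}K)\bigr)^4}{nK^4}.$$ -/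

import Mathlib

open scoped NNReal BigOperators

noncomputable section

namespace SEGFFA

/-- The space `ℝ^{d₁+d₂}` of concatenated vectors `z = (x, y)`, `x ∈ ℝ^{d₁}`, `y ∈ ℝ^{d₂}`, with the
Euclidean inner product and norm. -/
abbrev Z (d₁ d₂ : ℕ) : Type :=
  WithLp 2 (EuclideanSpace ℝ (Fin d₁) × EuclideanSpace ℝ (Fin d₂))

/-- Concatenation `(x, y)`. -/
abbrev pair {d₁ d₂ : ℕ} (x : EuclideanSpace ℝ (Fin d₁)) (y : EuclideanSpace ℝ (Fin d₂)) : Z d₁ d₂ :=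
  WithLp.toLp 2 (x, y)

/-- The saddle gradient `(∇ₓ g, -∇ᵧ g)` of a function `g(x, y)`. -/
def saddleGrad {d₁ d₂ : ℕ} (g : Z d₁ d₂ → ℝ) (z : Z d₁ d₂) : Z d₁ d₂ :=
  pair (gradient (fun x => g (pair x z.snd)) z.fst)
    (-gradient (fun y => g (pair z.fst y)) z.snd)

/-- The finite-sum objective `f = (1/n) ∑ᵢ fᵢ`. -/
def objective {d₁ d₂ n : ℕ} (f : Fin n → Z d₁ d₂ → ℝ) (z : Z d₁ d₂) : ℝ :=
  (1 / (n : ℝ)) * ∑ i, f i z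

/-- `F` is `μ`-strongly monotone. -/
def StronglyMonotone {d₁ d₂ : ℕ} (μ : ℝ) (F : Z d₁ d₂ → Z d₁ d₂) : Prop :=
  ∀ z w, μ * ‖z - w‖ ^ 2 ≤ inner ℝ (F z - F w) (z - w)

/-- `g` is `L`-smooth and its saddle gradient is `M`-smooth. -/
structure SmoothComponent {d₁ d₂ : ℕ} (L M : ℝ≥0) (g : Z d₁ d₂ → ℝ) : Prop where
  differentiable : Differentiable ℝ g
  lipschitz : LipschitzWith L (saddleGrad g)
  differentiable_saddleGrad : Differentiable ℝ (saddleGrad g)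
  lipschitz_fderiv : LipschitzWith M (fderiv ℝ (saddleGrad g))

/-- `zs = (x*, y*)` is an optimal solution of `min_x max_y g(x, y)`, i.e. a saddle point:
`g(x*, y) ≤ g(x*, y*) ≤ g(x, y*)` for all `x` and `y`. -/
def IsSaddlePoint {d₁ d₂ : ℕ} (g : Z d₁ d₂ → ℝ) (zs : Z d₁ d₂) : Prop :=
  ∀ x y, g (pair zs.fst y) ≤ g zs ∧ g zs ≤ g (pair x zs.snd)

/-- One same-sample extragradient step with the operator `T`:
`w = z - α T z`, then `z⁺ = z - β T w`. -/
def segStep {d₁ d₂ : ℕ} (T : Z d₁ d₂ → Z d₁ d₂) (α β : ℝ) (z : Z d₁ d₂) : Z d₁ d₂ :=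
  z - β • T (z - α • T z)

/-- The flip-flop order `0, 1, …, n-1, n-1, …, 1, 0` of the positions `i = 0, …, 2n-1`
(only these `i` are used, and for them both values below are less than `n`). -/
def flipFlop (n : ℕ) [NeZero n] (i : ℕ) : Fin n :=
  Fin.ofNat n (if i < n then i else 2 * n - 1 - i)

/-- The inner iterates `z₀, z₁, …, z_{2n}` of one flip-flop epoch with permutation `τ`. -/
def innerIter {d₁ d₂ n : ℕ} [NeZero n] (F : Fin n → Z d₁ d₂ → Z d₁ d₂) (α β : ℝ)
    (τ : Equiv.Perm (Fin n)) (z : Z d₁ d₂) : ℕ → Z d₁ d₂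
  | 0 => z
  | i + 1 => segStep (F (τ (flipFlop n i))) α β (innerIter F α β τ z i)

/-- One SEG-FFA epoch: `2n` flip-flop steps followed by the anchoring step
`(z₀ + z_{2n}) / 2`. -/
def epoch {d₁ d₂ n : ℕ} [NeZero n] (F : Fin n → Z d₁ d₂ → Z d₁ d₂) (α β : ℝ)
    (τ : Equiv.Perm (Fin n)) (z : Z d₁ d₂) : Z d₁ d₂ :=
  (1 / 2 : ℝ) • (z + innerIter F α β τ z (2 * n))

/-- The iterate `z₀^K` of SEG-FFA after `K` epochs, with stepsizes `α k`, `β k` and permutation `τ k`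
in epoch `k`, started at `z₀`. -/
def iterate {d₁ d₂ n : ℕ} [NeZero n] (F : Fin n → Z d₁ d₂ → Z d₁ d₂) (α β : ℕ → ℝ)
    (z₀ : Z d₁ d₂) : (K : ℕ) → (Fin K → Equiv.Perm (Fin n)) → Z d₁ d₂
  | 0, _ => z₀
  | K + 1, τ => epoch F (α K) (β K) (τ (Fin.last K))
      (iterate F α β z₀ K (fun k => τ k.castSucc))

/-- The expectation `E ‖z₀^K - zs‖²` over independent, uniformly distributed permutations
`τ₀, …, τ_{K-1}`, i.e. the average over all `K`-tuples of permutations. -/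
def meanSqDist {d₁ d₂ n : ℕ} [NeZero n] (F : Fin n → Z d₁ d₂ → Z d₁ d₂) (α β : ℕ → ℝ)
    (z₀ : Z d₁ d₂) (K : ℕ) (zs : Z d₁ d₂) : ℝ :=
  𝔼 τ : Fin K → Equiv.Perm (Fin n), ‖iterate F α β z₀ K τ - zs‖ ^ 2

end SEGFFA

end

namespace SEGFFA

/-! ### Second-order expansion of a palindromic pass. -/

section Palindrome

variable {E : Type*} [NormedAddCommGroup E] [InnerProductSpace ℝ E]

/-! With `h = nη`, one epoch agrees up to third order with the step `z - h F z + h² DF(z) F(z)`,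
whatever the permutation. Expanding a pass to second order produces the double sum of `DTᵢ Tₗ` over
`l < i`, which depends on the order, while the inner half step `α = η/2` adds half of the diagonal.
A flip-flop pass is a palindrome, so reflection identifies the two triangles and the total is
exactly half of the full product (`sum_palindrome`). Anchoring then halves the pass of length `2n`
and leaves the second-order expansion of an extragradient step for `F`. Strong monotonicity makes
this step a contraction for small `h`.

The remainder is controlled twice (`epoch_remainder_bounds`). A uniform bound `O(h³)` keeps all
iterates in a fixed ball. In mean square the remainder is `O(h⁶)` times `V + L²‖z - z*‖²`, where `V
= (1/n²) ∑ ‖Fⱼ z*‖² ≤ σ²/n`. The factor `1/n` comes from sampling without replacement: the `Fⱼ z*`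
sum to zero, so distinct draws have nonpositive correlation. The part proportional to the distance
is absorbed by the contraction (`perturbed_contraction`).

Iterating gives `exp(-μhK/4) ‖z₀ - z*‖² + O(h⁴ V)`. The choice `h = 16 log(n^{1/4} K)/(μK)`, capped
at a threshold `h₀`, balances the terms: uncapped, the exponential is `1/(nK⁴)`; capped, it is the
linear rate of the theorem. The saddle point is the unique zero of the strongly monotone Lipschitz
operator `F`. -/

lemma sum_palindrome (N : ℕ) (A : ℕ → E →L[ℝ] E) (b : ℕ → E)
    (hA : ∀ i < N, A (N - 1 - i) = A i) (hb : ∀ i < N, b (N - 1 - i) = b i) :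
    ∑ i ∈ Finset.range N, A i (∑ l ∈ Finset.range i, b l + (1 / 2 : ℝ) • b i)
      = (1 / 2 : ℝ) • (∑ i ∈ Finset.range N, A i) (∑ l ∈ Finset.range N, b l) := by
  have hlow : ∀ i ∈ Finset.range N, A i (∑ l ∈ Finset.range i, b l)
      = ∑ l ∈ Finset.range N, if l < i then A i (b l) else 0 := by
    intro i hi
    rw [map_sum, ← Finset.sum_filter]
    refine Finset.sum_congr ?_ fun _ _ => rfl
    ext l
    simp only [Finset.mem_range, Finset.mem_filter] at hi ⊢
    omega
  -- Reversing both indices exchanges `l < i` and `i < l` and fixes the summand, so both triangles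
  -- have the same sum.
  have hrefl : ∑ i ∈ Finset.range N, ∑ l ∈ Finset.range N, (if l < i then A i (b l) else 0)
      = ∑ i ∈ Finset.range N, ∑ l ∈ Finset.range N, (if i < l then A i (b l) else 0) := by
    rw [← Finset.sum_range_reflect]
    refine Finset.sum_congr rfl fun i hi => ?_
    rw [← Finset.sum_range_reflect]
    refine Finset.sum_congr rfl fun l hl => ?_
    rw [Finset.mem_range] at hi hl
    rw [hA i hi, hb l hl]
    congr 1
    simp only [eq_iff_iff]
    omega
  have hfull : (∑ i ∈ Finset.range N, A i) (∑ l ∈ Finset.range N, b l)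
      = ∑ i ∈ Finset.range N, ∑ l ∈ Finset.range N, (if l < i then A i (b l) else 0)
        + ∑ i ∈ Finset.range N, ∑ l ∈ Finset.range N, (if i < l then A i (b l) else 0)
        + ∑ i ∈ Finset.range N, A i (b i) := by
    rw [_root_.sum_apply, ← Finset.sum_add_distrib, ← Finset.sum_add_distrib]
    refine Finset.sum_congr rfl fun i hi => ?_
    have hdiag : A i (b i) = ∑ l ∈ Finset.range N, if i = l then A i (b l) else 0 := by
      rw [Finset.sum_ite_eq, if_pos hi]
    rw [map_sum, hdiag, ← Finset.sum_add_distrib, ← Finset.sum_add_distrib]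
    refine Finset.sum_congr rfl fun l _ => ?_
    rcases lt_trichotomy l i with h | h | h
    · simp [h, h.not_gt, h.ne']
    · simp [h]
    · simp [h, h.not_gt, h.ne]
  rw [hfull, ← hrefl]
  simp only [map_add, map_smul, Finset.sum_add_distrib]
  rw [Finset.sum_congr rfl hlow, ← Finset.smul_sum]
  module

lemma norm_taylor_le {T : E → E} {M : ℝ≥0} (hT : Differentiable ℝ T)
    (hM : LipschitzWith M (fderiv ℝ T)) (x y : E) :
    ‖T y - T x - fderiv ℝ T x (y - x)‖ ≤ M * ‖y - x‖ ^ 2 := by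
  have h := (convex_segment (𝕜 := ℝ) x y).norm_image_sub_le_of_norm_hasFDerivWithin_le'
    (f := T) (f' := fderiv ℝ T) (φ := fderiv ℝ T x) (C := M * ‖y - x‖)
    (fun u _ => (hT u).hasFDerivAt.hasFDerivWithinAt)
    (fun u hu => by
      refine (hM.norm_sub_le u x).trans (mul_le_mul_of_nonneg_left ?_ M.2)
      exact norm_sub_le_of_mem_segment hu)
    (left_mem_segment ℝ x y) (right_mem_segment ℝ x y)
  rw [pow_two, ← mul_assoc]
  exact h

/-- Second-order expansion of a palindromic sequence of same-sample extragradient steps. -/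
lemma norm_extragradient_expansion_le {N : ℕ} {T : ℕ → E → E} {L M : ℝ≥0} {η : ℝ} {z w : ℕ → E}
    (hη : 0 ≤ η) (hsmall : N * η * L ≤ 1 / 4)
    (hpal : ∀ i < N, T (N - 1 - i) = T i)
    (hL : ∀ i, LipschitzWith L (T i)) (hd : ∀ i, Differentiable ℝ (T i))
    (hM : ∀ i, LipschitzWith M (fderiv ℝ (T i)))
    (hw : ∀ i, w i = z i - (η / 2) • T i (z i)) (hz : ∀ i, z (i + 1) = z i - η • T i (w i))
    (S s : ℕ → E) (hS : ∀ i, S i = ∑ l ∈ Finset.range i, T l (z 0))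
    (hs : ∀ i, s i = S i + (1 / 2 : ℝ) • T i (z 0)) :
    ‖z N - (z 0 - η • ∑ i ∈ Finset.range N, T i (z 0)
        + (η ^ 2 / 2) • (∑ i ∈ Finset.range N, fderiv ℝ (T i) (z 0))
          (∑ i ∈ Finset.range N, T i (z 0)))‖
      ≤ 2 * N * η ^ 3 * L ^ 2 * ∑ i ∈ Finset.range N, (‖s i‖ + ‖S i‖)
        + 3 * M * η ^ 3 * ∑ i ∈ Finset.range N, (‖s i‖ ^ 2 + ‖S i‖ ^ 2) := by
  set Γ := ∑ i ∈ Finset.range N, (‖s i‖ + ‖S i‖) with hΓ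
  set Γ₂ := ∑ i ∈ Finset.range N, (‖s i‖ ^ 2 + ‖S i‖ ^ 2) with hΓ₂
  have hL0 : (0 : ℝ) ≤ L := L.2
  have hM0 : (0 : ℝ) ≤ M := M.2
  have hzsum : ∀ i, z i = z 0 - η • ∑ l ∈ Finset.range i, T l (w l) := by
    intro i
    induction i with
    | zero => simp
    | succ i ih => rw [hz, ih, Finset.sum_range_succ, smul_add, sub_sub]
  set G := ∑ i ∈ Finset.range N, (‖w i - z 0‖ + ‖z i - z 0‖) with hG
  have hG0 : 0 ≤ G := Finset.sum_nonneg fun _ _ => by positivity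
  have hlip : ∀ i u, ‖T i u - T i (z 0)‖ ≤ L * ‖u - z 0‖ := fun i u => (hL i).norm_sub_le u (z 0)
  have hpart : ∀ i < N, ∑ l ∈ Finset.range i, ‖w l - z 0‖ + ‖z i - z 0‖ ≤ G := by
    intro i hi
    rw [hG, Finset.sum_add_distrib]
    refine add_le_add ?_ ?_
    · exact Finset.sum_le_sum_of_subset_of_nonneg (Finset.range_mono hi.le)
        fun _ _ _ => norm_nonneg _
    · exact Finset.single_le_sum (f := fun i => ‖z i - z 0‖) (fun _ _ => norm_nonneg _)
        (Finset.mem_range.2 hi)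
  have hsumdiff : ∀ i, ‖∑ l ∈ Finset.range i, (T l (w l) - T l (z 0))‖
      ≤ L * ∑ l ∈ Finset.range i, ‖w l - z 0‖ := by
    intro i
    rw [Finset.mul_sum]
    exact norm_sum_le_of_le _ fun l _ => hlip l (w l)
  have hq : ∀ i < N, ‖z i - z 0 + η • S i‖ ≤ η * L * G := by
    intro i hi
    have : z i - z 0 + η • S i = -(η • ∑ l ∈ Finset.range i, (T l (w l) - T l (z 0))) := by
      rw [hS, hzsum i, Finset.sum_sub_distrib]; module
    rw [this, norm_neg, norm_smul, Real.norm_of_nonneg hη, mul_assoc]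
    refine mul_le_mul_of_nonneg_left ((hsumdiff i).trans ?_) hη
    refine mul_le_mul_of_nonneg_left ?_ hL0
    linarith [hpart i hi, norm_nonneg (z i - z 0)]
  -- The half step in `w` turns the partial sum `S i` into `s i`, the half-diagonal version needed
  -- for the palindrome identity.
  have hδ : ∀ i < N, ‖w i - z 0 + η • s i‖ ≤ η * L * G := by
    intro i hi
    have : w i - z 0 + η • s i = -(η • ((∑ l ∈ Finset.range i, (T l (w l) - T l (z 0)))
        + (1 / 2 : ℝ) • (T i (z i) - T i (z 0)))) := by
      rw [hw, hs, hS, Finset.sum_sub_distrib]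
      nth_rewrite 1 [hzsum i]
      module
    rw [this, norm_neg, norm_smul, Real.norm_of_nonneg hη, mul_assoc]
    refine mul_le_mul_of_nonneg_left ((norm_add_le _ _).trans ?_) hη
    have h1 := hsumdiff i
    have h2 : ‖(1 / 2 : ℝ) • (T i (z i) - T i (z 0))‖ ≤ L * ‖z i - z 0‖ := by
      rw [norm_smul]
      have := hlip i (z i)
      norm_num
      linarith [norm_nonneg (T i (z i) - T i (z 0))]
    have h3 := mul_le_mul_of_nonneg_left (hpart i hi) hL0
    linarith
  have hp' : ∀ i < N, ‖w i - z 0‖ ≤ η * ‖s i‖ + η * L * G := by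
    intro i hi
    have h1 : w i - z 0 = (w i - z 0 + η • s i) - η • s i := by abel
    have h2 := norm_sub_le (w i - z 0 + η • s i) (η • s i)
    rw [← h1, norm_smul, Real.norm_of_nonneg hη] at h2
    linarith [hδ i hi]
  have hq' : ∀ i < N, ‖z i - z 0‖ ≤ η * ‖S i‖ + η * L * G := by
    intro i hi
    have h1 : z i - z 0 = (z i - z 0 + η • S i) - η • S i := by abel
    have h2 := norm_sub_le (z i - z 0 + η • S i) (η • S i)
    rw [← h1, norm_smul, Real.norm_of_nonneg hη] at h2
    linarith [hq i hi]
  -- Self-bounding: summing the two estimates gives `G ≤ ηΓ + 2NηL·G`, and the last term is at most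
  -- `G/2` by `hsmall`.
  have hGΓ : G ≤ 2 * η * Γ := by
    have h1 : G ≤ ∑ i ∈ Finset.range N, (η * (‖s i‖ + ‖S i‖) + 2 * (η * L * G)) :=
      Finset.sum_le_sum fun i hi => by
        have hi := Finset.mem_range.1 hi
        linarith [hp' i hi, hq' i hi]
    rw [Finset.sum_add_distrib, ← Finset.mul_sum, Finset.sum_const, Finset.card_range,
      nsmul_eq_mul, ← hΓ] at h1
    have h2 : N * η * L * G ≤ 1 / 4 * G := mul_le_mul_of_nonneg_right hsmall hG0
    linarith
  have hΓ0 : 0 ≤ Γ := Finset.sum_nonneg fun _ _ => by positivity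
  have hδ' : ∀ i < N, ‖w i - z 0 + η • s i‖ ≤ 2 * η ^ 2 * L * Γ := by
    intro i hi
    refine (hδ i hi).trans ?_
    have := mul_le_mul_of_nonneg_left hGΓ (mul_nonneg hη hL0)
    linarith
  have hΓsq : Γ ^ 2 ≤ 2 * N * Γ₂ := by
    have h1 : Γ ^ 2 ≤ N * ∑ i ∈ Finset.range N, (‖s i‖ + ‖S i‖) ^ 2 := by
      simpa using sq_sum_le_card_mul_sum_sq (s := Finset.range N) (f := fun i => ‖s i‖ + ‖S i‖)
    have h2 : ∑ i ∈ Finset.range N, (‖s i‖ + ‖S i‖) ^ 2 ≤ 2 * Γ₂ := by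
      rw [hΓ₂, Finset.mul_sum]
      exact Finset.sum_le_sum fun i _ => by linarith [sq_nonneg (‖s i‖ - ‖S i‖)]
    have := mul_le_mul_of_nonneg_left h2 (Nat.cast_nonneg (α := ℝ) N)
    linarith
  have hΓ₂0 : 0 ≤ Γ₂ := Finset.sum_nonneg fun _ _ => by positivity
  -- The main term contributes `2η²Γ₂`; the correction is at most `16(NηL)²η²Γ₂ ≤ η²Γ₂`.
  have hpsq : ∑ i ∈ Finset.range N, ‖w i - z 0‖ ^ 2 ≤ 3 * η ^ 2 * Γ₂ := by
    have h1 : ∑ i ∈ Finset.range N, ‖w i - z 0‖ ^ 2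
        ≤ ∑ i ∈ Finset.range N, (2 * η ^ 2 * (‖s i‖ ^ 2 + ‖S i‖ ^ 2)
            + 2 * (2 * η ^ 2 * L * Γ) ^ 2) := by
      refine Finset.sum_le_sum fun i hi => ?_
      have hi := Finset.mem_range.1 hi
      have h2 : ‖w i - z 0‖ ≤ η * ‖s i‖ + 2 * η ^ 2 * L * Γ := by
        refine (hp' i hi).trans ?_
        have := mul_le_mul_of_nonneg_left hGΓ (mul_nonneg hη hL0)
        linarith
      have h3 := pow_le_pow_left₀ (norm_nonneg _) h2 2
      have h4 : 0 ≤ η ^ 2 * ‖S i‖ ^ 2 := by positivity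
      linarith [sq_nonneg (η * ‖s i‖ - 2 * η ^ 2 * L * Γ)]
    rw [Finset.sum_add_distrib, ← Finset.mul_sum, Finset.sum_const, Finset.card_range,
      nsmul_eq_mul, ← hΓ₂] at h1
    have h2 : (N * η * L) ^ 2 ≤ (1 / 4) ^ 2 := pow_le_pow_left₀ (by positivity) hsmall 2
    have h3 : 8 * N * η ^ 4 * L ^ 2 * Γ ^ 2 ≤ 8 * N * η ^ 4 * L ^ 2 * (2 * N * Γ₂) :=
      mul_le_mul_of_nonneg_left hΓsq (by positivity)
    have h4 := mul_le_mul_of_nonneg_right h2 (show 0 ≤ 16 * η ^ 2 * Γ₂ by positivity)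
    nlinarith
  have hcur : ∀ i, ‖fderiv ℝ (T i) (z 0)‖ ≤ L := fun i => norm_fderiv_le_of_lipschitz ℝ (hL i)
  -- After the palindrome identity removes the second-order terms, two errors remain: the derivative
  -- applied to the first-order error in `w i`, and the Taylor remainder of `T i`.
  have hmain : z N - (z 0 - η • ∑ i ∈ Finset.range N, T i (z 0)
        + (η ^ 2 / 2) • (∑ i ∈ Finset.range N, fderiv ℝ (T i) (z 0))
          (∑ i ∈ Finset.range N, T i (z 0)))
      = -(η • ∑ i ∈ Finset.range N, (fderiv ℝ (T i) (z 0) (w i - z 0 + η • s i)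
          + (T i (w i) - T i (z 0) - fderiv ℝ (T i) (z 0) (w i - z 0)))) := by
    have h1 := sum_palindrome N (fun i => fderiv ℝ (T i) (z 0)) (fun i => T i (z 0))
      (fun i hi => by simp only [hpal i hi]) (fun i hi => by simp only [hpal i hi])
    have h2 : ∑ i ∈ Finset.range N, (fderiv ℝ (T i) (z 0) (w i - z 0 + η • s i)
          + (T i (w i) - T i (z 0) - fderiv ℝ (T i) (z 0) (w i - z 0)))
        = ∑ i ∈ Finset.range N, T i (w i) - ∑ i ∈ Finset.range N, T i (z 0)
          + η • ∑ i ∈ Finset.range N, fderiv ℝ (T i) (z 0)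
            (∑ l ∈ Finset.range i, T l (z 0) + (1 / 2 : ℝ) • T i (z 0)) := by
      rw [Finset.smul_sum, ← Finset.sum_sub_distrib, ← Finset.sum_add_distrib]
      refine Finset.sum_congr rfl fun i _ => ?_
      rw [map_add, map_smul, hs, hS]
      abel
    rw [h2, h1, hzsum N]
    module
  rw [hmain, norm_neg, norm_smul, Real.norm_of_nonneg hη]
  have hterm : ‖∑ i ∈ Finset.range N, (fderiv ℝ (T i) (z 0) (w i - z 0 + η • s i)
          + (T i (w i) - T i (z 0) - fderiv ℝ (T i) (z 0) (w i - z 0)))‖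
      ≤ ∑ i ∈ Finset.range N, (L * (2 * η ^ 2 * L * Γ) + M * ‖w i - z 0‖ ^ 2) := by
    refine norm_sum_le_of_le _ fun i hi => (norm_add_le _ _).trans (add_le_add ?_ ?_)
    · exact (ContinuousLinearMap.le_opNorm _ _).trans
        (mul_le_mul (hcur i) (hδ' i (Finset.mem_range.1 hi)) (norm_nonneg _) hL0)
    · exact norm_taylor_le (hd i) (hM i) (z 0) (w i)
  have hsplit : ∑ i ∈ Finset.range N, (L * (2 * η ^ 2 * L * Γ) + M * ‖w i - z 0‖ ^ 2)
      = N * (L * (2 * η ^ 2 * L * Γ)) + M * ∑ i ∈ Finset.range N, ‖w i - z 0‖ ^ 2 := by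
    rw [Finset.sum_add_distrib, Finset.sum_const, Finset.card_range, nsmul_eq_mul,
      Finset.mul_sum _ _ (M : ℝ)]
  rw [hsplit] at hterm
  have h5 := mul_le_mul_of_nonneg_left hpsq hM0
  have h6 := mul_le_mul_of_nonneg_left (hterm.trans (add_le_add_right h5 _)) hη
  refine h6.trans (le_of_eq ?_)
  ring

end Palindrome

/-! ### Sampling without replacement. -/

section Permutation

variable {E : Type*} [NormedAddCommGroup E] [InnerProductSpace ℝ E]
variable {ι : Type*} [Fintype ι] [DecidableEq ι]

lemma expect_perm_apply (g : ι → ℝ) (p : ι) :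
    𝔼 τ : Equiv.Perm ι, g (τ p) = 𝔼 i, g i := by
  have : Nonempty ι := ⟨p⟩
  have hc : ∀ q, 𝔼 τ : Equiv.Perm ι, g (τ q) = 𝔼 τ : Equiv.Perm ι, g (τ p) := fun q =>
    Fintype.expect_equiv (Equiv.mulRight (Equiv.swap p q)) _ _ fun τ => by simp
  calc 𝔼 τ : Equiv.Perm ι, g (τ p) = 𝔼 _q : ι, 𝔼 τ : Equiv.Perm ι, g (τ p) := by
        rw [Fintype.expect_const]
    _ = 𝔼 q : ι, 𝔼 τ : Equiv.Perm ι, g (τ q) := by simp only [hc]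
    _ = 𝔼 τ : Equiv.Perm ι, 𝔼 q : ι, g (τ q) := Finset.expect_comm _ _ _
    _ = 𝔼 _τ : Equiv.Perm ι, 𝔼 i, g i :=
        Finset.expect_congr rfl fun τ _ => Fintype.expect_equiv τ _ _ fun _ => rfl
    _ = 𝔼 i, g i := by rw [Fintype.expect_const]

/-- By exchangeability all `q ≠ p` give the same mean. Together with the nonnegative diagonal term
these means add up to zero, because the family is centred. -/
lemma expect_perm_inner_nonpos (v : ι → E) (hv : ∑ i, v i = 0) {p q : ι} (hpq : p ≠ q) :
    𝔼 τ : Equiv.Perm ι, inner ℝ (v (τ p)) (v (τ q)) ≤ 0 := by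
  set c : ι → ℝ := fun q => 𝔼 τ : Equiv.Perm ι, inner ℝ (v (τ p)) (v (τ q)) with hcdef
  have hc : ∀ q' ∈ Finset.univ.erase p, c q' = c q := fun q' hq' =>
    Fintype.expect_equiv (Equiv.mulRight (Equiv.swap q q')) _ _ fun τ => by
      have : p ≠ q' := (Finset.ne_of_mem_erase hq').symm
      simp [Equiv.swap_apply_of_ne_of_ne hpq this]
  have hsum : ∑ q', c q' = 0 := by
    rw [hcdef, ← Finset.expect_sum_comm]
    refine Finset.expect_eq_zero fun τ _ => ?_
    rw [← inner_sum, Equiv.sum_comp τ v, hv, inner_zero_right]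
  have hp : 0 ≤ c p := Finset.expect_nonneg fun τ _ => real_inner_self_nonneg
  rw [← Finset.add_sum_erase _ _ (Finset.mem_univ p), Finset.sum_congr rfl hc, Finset.sum_const,
    nsmul_eq_mul] at hsum
  have hcard : 0 < (((Finset.univ.erase p).card : ℕ) : ℝ) :=
    Nat.cast_pos.2 (Finset.card_pos.2 ⟨q, by simp [hpq.symm]⟩)
  change c q ≤ 0
  by_contra! h
  nlinarith [mul_pos hcard h]

/-- Second moment of a nonnegatively weighted sum of a centred family sampled without
replacement. -/
lemma expect_perm_norm_sq_sum_le (v : ι → E) (hv : ∑ i, v i = 0) (m : ι → ℝ) (hm : ∀ p, 0 ≤ m p) :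
    𝔼 τ : Equiv.Perm ι, ‖∑ p, m p • v (τ p)‖ ^ 2 ≤ (∑ p, m p ^ 2) * 𝔼 i, ‖v i‖ ^ 2 := by
  have hexp : ∀ τ : Equiv.Perm ι, ‖∑ p, m p • v (τ p)‖ ^ 2
      = ∑ p, ∑ q, m p * m q * inner ℝ (v (τ p)) (v (τ q)) := by
    intro τ
    rw [← real_inner_self_eq_norm_sq, sum_inner]
    refine Finset.sum_congr rfl fun p _ => ?_
    rw [inner_sum]
    refine Finset.sum_congr rfl fun q _ => ?_
    rw [real_inner_smul_left, real_inner_smul_right, mul_assoc]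
  simp only [hexp]
  rw [Finset.expect_sum_comm, Finset.sum_mul]
  refine Finset.sum_le_sum fun p _ => ?_
  rw [Finset.expect_sum_comm, ← Finset.add_sum_erase _ _ (Finset.mem_univ p)]
  have h1 : 𝔼 τ : Equiv.Perm ι, m p * m p * inner ℝ (v (τ p)) (v (τ p))
      = m p ^ 2 * 𝔼 i, ‖v i‖ ^ 2 := by
    rw [← Finset.mul_expect, ← expect_perm_apply (fun i => ‖v i‖ ^ 2) p, pow_two]
    simp only [real_inner_self_eq_norm_sq]
  have h2 : ∑ q ∈ Finset.univ.erase p,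
      𝔼 τ : Equiv.Perm ι, m p * m q * inner ℝ (v (τ p)) (v (τ q)) ≤ 0 := by
    refine Finset.sum_nonpos fun q hq => ?_
    rw [← Finset.mul_expect]
    exact mul_nonpos_of_nonneg_of_nonpos (mul_nonneg (hm p) (hm q))
      (expect_perm_inner_nonpos v hv (Finset.ne_of_mem_erase hq).symm)
  linarith

end Permutation

/-! ### Flip-flop passes and their partial sums. -/

section FlipFlop

lemma flipFlop_reflect (n : ℕ) [NeZero n] {i : ℕ} (hi : i < 2 * n) :
    flipFlop n (2 * n - 1 - i) = flipFlop n i := by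
  unfold flipFlop
  congr 1
  split_ifs <;> omega

lemma sum_flipFlop {M : Type*} [AddCommMonoid M] (n : ℕ) [NeZero n] (g : Fin n → M) :
    ∑ i ∈ Finset.range (2 * n), g (flipFlop n i) = 2 • ∑ p, g p := by
  have h1 : ∑ i ∈ Finset.range n, g (flipFlop n i) = ∑ p, g p := by
    rw [Finset.sum_range]
    refine Finset.sum_congr rfl fun p _ => ?_
    simp [flipFlop]
  have h2 : ∑ i ∈ Finset.range n, g (flipFlop n (n + i)) = ∑ p, g p := by
    rw [← h1, ← Finset.sum_range_reflect]
    refine Finset.sum_congr rfl fun i hi => ?_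
    rw [Finset.mem_range] at hi
    rw [← flipFlop_reflect n (i := i) (by omega)]
    congr 2
    omega
  rw [two_mul, Finset.sum_range_add, h1, h2, two_smul]

variable {E : Type*} [NormedAddCommGroup E] [InnerProductSpace ℝ E]

/-- Second moment of the (corrected) partial sums along a flip-flop pass. -/
lemma expect_norm_sq_flipFlop_partial_sum_le {n : ℕ} [NeZero n] (v : Fin n → E)
    (hv : ∑ j, v j = 0) {θ : ℝ} (hθ : 0 ≤ θ) (hθ' : θ ≤ 1) {i : ℕ} (hi : i < 2 * n) :
    𝔼 τ : Equiv.Perm (Fin n),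
        ‖∑ l ∈ Finset.range i, v (τ (flipFlop n l)) + θ • v (τ (flipFlop n i))‖ ^ 2
      ≤ 4 * ∑ j, ‖v j‖ ^ 2 := by
  -- `m p` counts the visits to position `p`, the next step having weight `θ`. A full pass visits
  -- each position twice, so `m p ≤ 2`.
  set m : Fin n → ℝ := fun p => ∑ l ∈ Finset.range i, (if flipFlop n l = p then 1 else 0)
    + θ * (if flipFlop n i = p then 1 else 0) with hm
  have hm0 : ∀ p, 0 ≤ m p := fun p => by
    have : 0 ≤ ∑ l ∈ Finset.range i, (if flipFlop n l = p then (1 : ℝ) else 0) :=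
      Finset.sum_nonneg fun _ _ => by positivity
    simp only [hm]
    positivity
  have hm2 : ∀ p, m p ≤ 2 := fun p => by
    have h1 := sum_flipFlop n (fun q => if q = p then (1 : ℝ) else 0)
    rw [Finset.sum_ite_eq' Finset.univ p, if_pos (Finset.mem_univ p)] at h1
    have h2 : m p ≤ ∑ l ∈ Finset.range (i + 1), (if flipFlop n l = p then (1 : ℝ) else 0) := by
      rw [Finset.sum_range_succ]
      simp only [hm]
      gcongr
      split_ifs <;> linarith
    refine (h2.trans (Finset.sum_le_sum_of_subset_of_nonneg (Finset.range_mono hi)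
      fun _ _ _ => by positivity)).trans (h1.le.trans (by norm_num))
  have hrepr : ∀ τ : Equiv.Perm (Fin n),
      ∑ l ∈ Finset.range i, v (τ (flipFlop n l)) + θ • v (τ (flipFlop n i))
        = ∑ p, m p • v (τ p) := by
    intro τ
    simp only [hm, add_smul, Finset.sum_add_distrib, Finset.sum_smul, ite_smul, one_smul,
      zero_smul, mul_ite, mul_one, mul_zero]
    rw [Finset.sum_comm]
    simp
  simp only [hrepr]
  refine (expect_perm_norm_sq_sum_le v hv m hm0).trans ?_
  have hn : (0 : ℝ) < n := Nat.cast_pos.2 (NeZero.pos n)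
  have h3 : ∑ p, m p ^ 2 ≤ n * 4 := by
    have : ∑ p, m p ^ 2 ≤ ∑ _p : Fin n, (4 : ℝ) := Finset.sum_le_sum fun p _ => by
      nlinarith [hm0 p, hm2 p]
    simpa using this
  have h4 : 𝔼 j, ‖v j‖ ^ 2 = (∑ j, ‖v j‖ ^ 2) / n := by
    rw [Fintype.expect_eq_sum_div_card, Fintype.card_fin]
  rw [h4]
  have h5 : 0 ≤ (∑ j, ‖v j‖ ^ 2) / n := by positivity
  refine (mul_le_mul_of_nonneg_right h3 h5).trans (le_of_eq ?_)
  field_simp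

end FlipFlop

/-! ### Contraction of the deterministic step. -/

section Epoch

variable {E : Type*} [NormedAddCommGroup E] [InnerProductSpace ℝ E]

/-- Contraction of the deterministic second-order step. -/
lemma norm_second_order_step_le {F : E → E} {A : E →L[ℝ] E} {L μ h : ℝ} {z zs : E}
    (hL0 : 0 ≤ L) (hh : 0 ≤ h) (hsmall : 3 * L ^ 2 * h ≤ μ) (hμh : μ * h ≤ 1)
    (hF : ‖F z‖ ≤ L * ‖z - zs‖) (hA : ‖A‖ ≤ L)
    (hmono : μ * ‖z - zs‖ ^ 2 ≤ inner ℝ (F z) (z - zs)) :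
    ‖z - h • F z + h ^ 2 • A (F z) - zs‖ ≤ (1 - μ * h / 2) * ‖z - zs‖ := by
  set d := ‖z - zs‖ with hd
  have hd0 : 0 ≤ d := norm_nonneg _
  -- The squared factor `1 - 2μh + L²h²` is at most the square of `1 - μh + L²h²/2`, which avoids a
  -- square root.
  have h1 : ‖(z - zs) - h • F z‖ ≤ (1 - μ * h + L ^ 2 * h ^ 2 / 2) * d := by
    have h0 : 0 ≤ 1 - μ * h + L ^ 2 * h ^ 2 / 2 := by
      nlinarith [mul_nonneg (sq_nonneg L) (sq_nonneg h)]
    refine le_of_sq_le_sq ?_ (mul_nonneg h0 hd0)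
    · rw [norm_sub_sq_real, real_inner_smul_right, norm_smul, Real.norm_of_nonneg hh,
        real_inner_comm, ← hd]
      have h2 := mul_le_mul_of_nonneg_left hmono hh
      have h3 : (h * ‖F z‖) ^ 2 ≤ (h * (L * d)) ^ 2 :=
        pow_le_pow_left₀ (by positivity) (mul_le_mul_of_nonneg_left hF hh) 2
      have h4 : 0 ≤ (μ * h - L ^ 2 * h ^ 2 / 2) ^ 2 * d ^ 2 := by positivity
      nlinarith
  have h2 : ‖h ^ 2 • A (F z)‖ ≤ h ^ 2 * (L * (L * d)) := by
    rw [norm_smul, Real.norm_of_nonneg (sq_nonneg h)]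
    refine mul_le_mul_of_nonneg_left ?_ (sq_nonneg h)
    exact (A.le_opNorm _).trans (mul_le_mul hA hF (norm_nonneg _) hL0)
  have h3 : z - h • F z + h ^ 2 • A (F z) - zs = ((z - zs) - h • F z) + h ^ 2 • A (F z) := by
    abel
  rw [h3]
  refine (norm_add_le _ _).trans ((add_le_add h1 h2).trans ?_)
  -- The quadratic losses `L²h²/2` and `L²h²` add up to `3L²h²/2 ≤ μh/2`.
  have h4 := mul_le_mul_of_nonneg_right hsmall (mul_nonneg hh hd0)
  nlinarith

end Epoch

/-! ### Moments of partial sums of noncentred families. -/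

section PartialSums

lemma sum_norm_le_of_sum_sq_le {E : Type*} [NormedAddCommGroup E] {n : ℕ} (v : Fin n → E) {σ : ℝ}
    (hσ : 0 ≤ σ) (h : ∑ j, ‖v j‖ ^ 2 ≤ n * σ ^ 2) : ∑ j, ‖v j‖ ≤ n * σ := by
  have h1 : (∑ j, ‖v j‖) ^ 2 ≤ n * ∑ j, ‖v j‖ ^ 2 := by
    simpa using sq_sum_le_card_mul_sum_sq (s := Finset.univ) (f := fun j => ‖v j‖)
  have hn : (0 : ℝ) ≤ n := Nat.cast_nonneg n
  refine le_of_sq_le_sq ?_ (by positivity)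
  have := mul_le_mul_of_nonneg_left h hn
  linarith

variable {E : Type*} [NormedAddCommGroup E] [InnerProductSpace ℝ E] {n : ℕ} [NeZero n]

/-- The sum of the first `i` vectors along a flip-flop pass, plus `θ` times the next one. -/
noncomputable def flipFlopPartial (u : Fin n → E) (θ : ℝ) (τ : Equiv.Perm (Fin n)) (i : ℕ) : E :=
  ∑ l ∈ Finset.range i, u (τ (flipFlop n l)) + θ • u (τ (flipFlop n i))

lemma norm_flipFlopPartial_le (u : Fin n → E) {θ : ℝ} (hθ : 0 ≤ θ) (hθ' : θ ≤ 1)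
    (τ : Equiv.Perm (Fin n)) {i : ℕ} (hi : i < 2 * n) :
    ‖flipFlopPartial u θ τ i‖ ≤ 2 * ∑ j, ‖u j‖ := by
  have h1 : ‖flipFlopPartial u θ τ i‖ ≤ ∑ l ∈ Finset.range (i + 1), ‖u (τ (flipFlop n l))‖ := by
    rw [Finset.sum_range_succ]
    refine (norm_add_le _ _).trans (add_le_add (norm_sum_le _ _) ?_)
    rw [norm_smul, Real.norm_of_nonneg hθ]
    exact mul_le_of_le_one_left (norm_nonneg _) hθ'
  have h2 := sum_flipFlop n (fun p => ‖u (τ p)‖)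
  rw [Equiv.sum_comp τ (fun j => ‖u j‖), nsmul_eq_mul, Nat.cast_ofNat] at h2
  rw [← h2]
  exact h1.trans (Finset.sum_le_sum_of_subset_of_nonneg (Finset.range_mono hi)
    fun _ _ _ => norm_nonneg _)

lemma flipFlopPartial_add (u v : Fin n → E) (θ : ℝ) (τ : Equiv.Perm (Fin n)) (i : ℕ) :
    flipFlopPartial (u + v) θ τ i = flipFlopPartial u θ τ i + flipFlopPartial v θ τ i := by
  simp only [flipFlopPartial, Pi.add_apply, Finset.sum_add_distrib, smul_add]
  abel

/-- Meant for `u j = T j z` and `v j = T j zs`: only the centred part `v` needs cancellation. The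
difference is bounded crudely, since with `δ = L‖z - zs‖` its cost can be absorbed by the
contraction. -/
lemma expect_norm_sq_flipFlopPartial_le (u v : Fin n → E) (hv : ∑ j, v j = 0) {δ : ℝ}
    (huv : ∀ j, ‖u j - v j‖ ≤ δ) {θ : ℝ} (hθ : 0 ≤ θ) (hθ' : θ ≤ 1) {i : ℕ} (hi : i < 2 * n) :
    𝔼 τ : Equiv.Perm (Fin n), ‖flipFlopPartial u θ τ i‖ ^ 2
      ≤ 8 * ∑ j, ‖v j‖ ^ 2 + 8 * n ^ 2 * δ ^ 2 := by
  have h1 : ∀ τ : Equiv.Perm (Fin n), ‖flipFlopPartial u θ τ i‖ ^ 2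
      ≤ 2 * ‖flipFlopPartial v θ τ i‖ ^ 2 + 8 * n ^ 2 * δ ^ 2 := by
    intro τ
    have h2 : ‖flipFlopPartial (u - v) θ τ i‖ ≤ 2 * (n * δ) := by
      refine (norm_flipFlopPartial_le (u - v) hθ hθ' τ hi).trans ?_
      refine mul_le_mul_of_nonneg_left ?_ zero_le_two
      refine (Finset.sum_le_sum fun j _ => huv j).trans ?_
      simp
    have h3 : flipFlopPartial u θ τ i
        = flipFlopPartial v θ τ i + flipFlopPartial (u - v) θ τ i := by
      rw [← flipFlopPartial_add, add_sub_cancel]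
    have h4 := pow_le_pow_left₀ (norm_nonneg _)
      ((h3 ▸ norm_add_le (flipFlopPartial v θ τ i) (flipFlopPartial (u - v) θ τ i)).trans
        (add_le_add_right h2 _)) 2
    linarith [sq_nonneg (‖flipFlopPartial v θ τ i‖ - 2 * (n * δ))]
  refine (Finset.expect_le_expect fun τ _ => h1 τ).trans ?_
  rw [Finset.expect_add_distrib, Fintype.expect_const, ← Finset.mul_expect]
  have h5 := expect_norm_sq_flipFlop_partial_sum_le v hv hθ hθ' hi
  simp only [flipFlopPartial]
  linarith

end PartialSums

/-! ### One epoch against its deterministic approximation. -/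

section Epoch

variable {d₁ d₂ n : ℕ} [NeZero n]

/-- The average of a finite family of vectors. -/
noncomputable def avg {E : Type*} [AddCommGroup E] [Module ℝ E] (u : Fin n → E) : E :=
  (1 / (n : ℝ)) • ∑ j, u j

/-- The deterministic second-order approximation of one epoch. -/
noncomputable def secondOrderStep (T : Fin n → Z d₁ d₂ → Z d₁ d₂) (h : ℝ) (z : Z d₁ d₂) : Z d₁ d₂ :=
  z - h • avg (fun j => T j z)
    + h ^ 2 • avg (fun j => fderiv ℝ (T j) z) (avg (fun j => T j z))

variable {T : Fin n → Z d₁ d₂ → Z d₁ d₂} {L M : ℝ≥0}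

/-- Both sums over a pass are `2n` times an average, independently of `τ`. After anchoring, the
coefficients are `(1/2)·2nη = h` and `(1/2)·(η²/2)·(2n)² = h²`, with `h = nη`. -/
lemma norm_epoch_sub_secondOrderStep_le {η : ℝ} (hη : 0 ≤ η) (hsmall : 8 * (n * η) * L ≤ 1)
    (hL : ∀ i, LipschitzWith L (T i)) (hd : ∀ i, Differentiable ℝ (T i))
    (hM : ∀ i, LipschitzWith M (fderiv ℝ (T i))) (τ : Equiv.Perm (Fin n)) (z : Z d₁ d₂) :
    ‖epoch T (η / 2) η τ z - secondOrderStep T (n * η) z‖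
      ≤ 2 * n * η ^ 3 * L ^ 2 * ∑ i ∈ Finset.range (2 * n),
          (‖flipFlopPartial (fun j => T j z) (1 / 2) τ i‖
            + ‖flipFlopPartial (fun j => T j z) 0 τ i‖)
        + 3 / 2 * M * η ^ 3 * ∑ i ∈ Finset.range (2 * n),
          (‖flipFlopPartial (fun j => T j z) (1 / 2) τ i‖ ^ 2
            + ‖flipFlopPartial (fun j => T j z) 0 τ i‖ ^ 2) := by
  have hn : (n : ℝ) ≠ 0 := Nat.cast_ne_zero.2 (NeZero.ne n)
  have key := norm_extragradient_expansion_le (N := 2 * n) (T := fun i => T (τ (flipFlop n i)))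
    (L := L) (M := M) (η := η) (z := innerIter T (η / 2) η τ z)
    (w := fun i => innerIter T (η / 2) η τ z i
      - (η / 2) • T (τ (flipFlop n i)) (innerIter T (η / 2) η τ z i)) hη
    (by push_cast; linarith) (fun i hi => by rw [flipFlop_reflect n hi]) (fun i => hL _)
    (fun i => hd _) (fun i => hM _) (fun i => rfl) (fun i => rfl)
    (fun i => flipFlopPartial (fun j => T j z) 0 τ i)
    (fun i => flipFlopPartial (fun j => T j z) (1 / 2) τ i)
    (fun i => by simp [flipFlopPartial, innerIter]) (fun i => by simp [flipFlopPartial, innerIter])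
  have h1 : ∑ i ∈ Finset.range (2 * n), T (τ (flipFlop n i)) z
      = (2 * n : ℝ) • avg (fun j => T j z) := by
    rw [sum_flipFlop n (fun p => T (τ p) z), Equiv.sum_comp τ (fun j => T j z), avg, smul_smul,
      mul_assoc, mul_one_div_cancel hn, mul_one, two_smul, two_smul]
  have h2 : ∑ i ∈ Finset.range (2 * n), fderiv ℝ (T (τ (flipFlop n i))) z
      = (2 * n : ℝ) • avg (fun j => fderiv ℝ (T j) z) := by
    rw [sum_flipFlop n (fun p => fderiv ℝ (T (τ p)) z),
      Equiv.sum_comp τ (fun j => fderiv ℝ (T j) z), avg, smul_smul,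
      mul_assoc, mul_one_div_cancel hn, mul_one, two_nsmul]
    exact (two_smul ℝ _).symm
  have h0 : innerIter T (η / 2) η τ z 0 = z := rfl
  simp only [h0] at key
  rw [h1, h2] at key
  have h3 : epoch T (η / 2) η τ z - secondOrderStep T (n * η) z
      = (1 / 2 : ℝ) • (innerIter T (η / 2) η τ z (2 * n)
        - (z - η • (2 * n : ℝ) • avg (fun j => T j z)
          + (η ^ 2 / 2) • ((2 * n : ℝ) • avg (fun j => fderiv ℝ (T j) z))
            ((2 * n : ℝ) • avg (fun j => T j z)))) := by
    rw [_root_.smul_apply, map_smul, epoch, secondOrderStep]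
    module
  rw [h3, norm_smul]
  push_cast at key
  norm_num at key ⊢
  linarith

lemma norm_avg_le {E : Type*} [NormedAddCommGroup E] [NormedSpace ℝ E] (u : Fin n → E) {C : ℝ}
    (hu : ∀ j, ‖u j‖ ≤ C) : ‖avg u‖ ≤ C := by
  have hn : (0 : ℝ) < n := Nat.cast_pos.2 (NeZero.pos n)
  rw [avg, norm_smul, Real.norm_of_nonneg (by positivity), one_div, inv_mul_le_iff₀ hn]
  refine (norm_sum_le_of_le _ fun j _ => hu j).trans (le_of_eq ?_)
  simp

lemma norm_secondOrderStep_sub_le {μ h : ℝ} (hh : 0 ≤ h) (hsmall : 3 * L ^ 2 * h ≤ μ)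
    (hμh : μ * h ≤ 1) (hL : ∀ i, LipschitzWith L (T i)) {z zs : Z d₁ d₂}
    (hzero : ∑ j, T j zs = 0)
    (hmono : μ * ‖z - zs‖ ^ 2 ≤ inner ℝ (avg (fun j => T j z)) (z - zs)) :
    ‖secondOrderStep T h z - zs‖ ≤ (1 - μ * h / 2) * ‖z - zs‖ := by
  refine norm_second_order_step_le (F := fun z => avg (fun j => T j z))
    (A := avg (fun j => fderiv ℝ (T j) z)) L.2 hh hsmall hμh ?_ ?_ hmono
  · have h1 : avg (fun j => T j z) = avg (fun j => T j z - T j zs) := by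
      rw [avg, avg, Finset.sum_sub_distrib, hzero, sub_zero]
    change ‖avg (fun j => T j z)‖ ≤ _
    rw [h1]
    exact norm_avg_le _ fun j => (hL j).norm_sub_le z zs
  · exact norm_avg_le _ fun j => norm_fderiv_le_of_lipschitz ℝ (hL j)

/-- Bounds on the distance between one epoch and its deterministic approximation: a uniform one
of third order, and one in mean square that improves with the number of components. -/
lemma epoch_remainder_bounds {η σ R B : ℝ} (hη : 0 ≤ η) (hσ : 0 ≤ σ)
    (hsmall : 8 * (n * η) * L ≤ 1) (hL : ∀ i, LipschitzWith L (T i))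
    (hd : ∀ i, Differentiable ℝ (T i)) (hM : ∀ i, LipschitzWith M (fderiv ℝ (T i)))
    {z zs : Z d₁ d₂} (hzero : ∑ j, T j zs = 0) (hzR : ‖z - zs‖ ≤ R)
    (hvar : ∑ j, ‖T j zs‖ ^ 2 ≤ n * σ ^ 2) (hB : B = 2 * (σ + L * R)) :
    (∀ τ, ‖epoch T (η / 2) η τ z - secondOrderStep T (n * η) z‖
      ≤ (8 * L ^ 2 * B + 6 * M * B ^ 2) * (n * η) ^ 3) ∧
    𝔼 τ, ‖epoch T (η / 2) η τ z - secondOrderStep T (n * η) z‖ ^ 2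
      ≤ 32 * (32 * L ^ 4 + 18 * M ^ 2 * B ^ 2) * (n * η) ^ 6
        * ((∑ j, ‖T j zs‖ ^ 2) / n ^ 2 + L ^ 2 * ‖z - zs‖ ^ 2) := by
  have hn : (0 : ℝ) < n := Nat.cast_pos.2 (NeZero.pos n)
  have hL0 : (0 : ℝ) ≤ L := L.2
  have hM0 : (0 : ℝ) ≤ M := M.2
  have hR0 : 0 ≤ R := (norm_nonneg _).trans hzR
  have hB0 : 0 ≤ B := by rw [hB]; positivity
  set p : ℝ → Equiv.Perm (Fin n) → ℕ → ℝ :=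
    fun θ τ i => ‖flipFlopPartial (fun j => T j z) θ τ i‖ with hp
  have hp0 : ∀ θ τ i, 0 ≤ p θ τ i := fun _ _ _ => norm_nonneg _
  have hpB : ∀ θ, 0 ≤ θ → θ ≤ 1 → ∀ τ, ∀ i ∈ Finset.range (2 * n), p θ τ i ≤ n * B := by
    intro θ h0 h1 τ i hi
    refine (norm_flipFlopPartial_le _ h0 h1 τ (Finset.mem_range.1 hi)).trans ?_
    have h2 : ∑ j, ‖T j z‖ ≤ ∑ j, (‖T j zs‖ + L * R) := Finset.sum_le_sum fun j _ => by
      have := norm_sub_norm_le (T j z) (T j zs)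
      linarith [(hL j).norm_sub_le z zs, mul_le_mul_of_nonneg_left hzR hL0]
    rw [Finset.sum_add_distrib] at h2
    have h3 := sum_norm_le_of_sum_sq_le _ hσ hvar
    simp only [Finset.sum_const, Finset.card_univ, Fintype.card_fin, nsmul_eq_mul] at h2
    rw [hB]
    linarith
  set Γ : Equiv.Perm (Fin n) → ℝ :=
    fun τ => ∑ i ∈ Finset.range (2 * n), (p (1 / 2) τ i + p 0 τ i) with hΓ
  set Γ₂ : Equiv.Perm (Fin n) → ℝ :=
    fun τ => ∑ i ∈ Finset.range (2 * n), (p (1 / 2) τ i ^ 2 + p 0 τ i ^ 2) with hΓ₂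
  have hr : ∀ τ, ‖epoch T (η / 2) η τ z - secondOrderStep T (n * η) z‖
      ≤ 2 * n * η ^ 3 * L ^ 2 * Γ τ + 3 / 2 * M * η ^ 3 * Γ₂ τ :=
    fun τ => norm_epoch_sub_secondOrderStep_le hη hsmall hL hd hM τ z
  have hΓ0 : ∀ τ, 0 ≤ Γ τ := fun τ => Finset.sum_nonneg fun i _ =>
    add_nonneg (hp0 _ _ _) (hp0 _ _ _)
  have hΓ₂0 : ∀ τ, 0 ≤ Γ₂ τ := fun τ => Finset.sum_nonneg fun i _ => by positivity
  have hΓB : ∀ τ, Γ τ ≤ 4 * n ^ 2 * B := fun τ => by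
    have : Γ τ ≤ ∑ i ∈ Finset.range (2 * n), (n * B + n * B) := Finset.sum_le_sum fun i hi =>
      add_le_add (hpB _ (by norm_num) (by norm_num) τ i hi) (hpB _ le_rfl zero_le_one τ i hi)
    refine this.trans (le_of_eq ?_)
    simp only [Finset.sum_const, Finset.card_range, nsmul_eq_mul]
    push_cast
    ring
  have hΓ₂B : ∀ τ, Γ₂ τ ≤ 4 * n ^ 3 * B ^ 2 := fun τ => by
    have : Γ₂ τ ≤ ∑ i ∈ Finset.range (2 * n), ((n * B) ^ 2 + (n * B) ^ 2) :=
      Finset.sum_le_sum fun i hi => add_le_add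
        (pow_le_pow_left₀ (hp0 _ _ _) (hpB _ (by norm_num) (by norm_num) τ i hi) 2)
        (pow_le_pow_left₀ (hp0 _ _ _) (hpB _ le_rfl zero_le_one τ i hi) 2)
    refine this.trans (le_of_eq ?_)
    simp only [Finset.sum_const, Finset.card_range, nsmul_eq_mul]
    push_cast
    ring
  have hΓsq : ∀ τ, Γ τ ^ 2 ≤ 4 * n * Γ₂ τ := fun τ => by
    have h1 : Γ τ ^ 2 ≤ ((2 * n : ℕ) : ℝ)
        * ∑ i ∈ Finset.range (2 * n), (p (1 / 2) τ i + p 0 τ i) ^ 2 := by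
      have := sq_sum_le_card_mul_sum_sq (s := Finset.range (2 * n))
        (f := fun i => p (1 / 2) τ i + p 0 τ i)
      rwa [Finset.card_range] at this
    have h2 : ∑ i ∈ Finset.range (2 * n), (p (1 / 2) τ i + p 0 τ i) ^ 2 ≤ 2 * Γ₂ τ := by
      rw [hΓ₂, Finset.mul_sum]
      exact Finset.sum_le_sum fun i _ => by linarith [sq_nonneg (p (1 / 2) τ i - p 0 τ i)]
    have h3 := mul_le_mul_of_nonneg_left h2 (Nat.cast_nonneg (α := ℝ) (2 * n))
    push_cast at h1 h3
    linarith
  refine ⟨fun τ => (hr τ).trans ?_, ?_⟩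
  · have h1 := mul_le_mul_of_nonneg_left (hΓB τ)
      (show 0 ≤ 2 * n * η ^ 3 * (L : ℝ) ^ 2 by positivity)
    have h2 := mul_le_mul_of_nonneg_left (hΓ₂B τ)
      (show 0 ≤ 3 / 2 * M * η ^ 3 by positivity)
    refine (add_le_add h1 h2).trans (le_of_eq ?_)
    ring
  -- Cauchy–Schwarz bounds `Γ²` by `Γ₂`, and one factor of `Γ₂²` is replaced by its worst case. The
  -- bound is thus linear in `Γ₂`, so second moments suffice.
  · have hrsq : ∀ τ, ‖epoch T (η / 2) η τ z - secondOrderStep T (n * η) z‖ ^ 2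
        ≤ (32 * L ^ 4 + 18 * M ^ 2 * B ^ 2) * n ^ 3 * η ^ 6 * Γ₂ τ := fun τ => by
      have h1 := pow_le_pow_left₀ (norm_nonneg _) (hr τ) 2
      have h2 := mul_le_mul_of_nonneg_left (hΓsq τ)
        (show 0 ≤ 8 * n ^ 2 * η ^ 6 * (L : ℝ) ^ 4 by positivity)
      have h3 := mul_le_mul_of_nonneg_right (hΓ₂B τ) (hΓ₂0 τ)
      have h4 := mul_le_mul_of_nonneg_left h3
        (show 0 ≤ 9 / 2 * (M : ℝ) ^ 2 * η ^ 6 by positivity)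
      have h5 := sq_nonneg (2 * n * η ^ 3 * L ^ 2 * Γ τ - 3 / 2 * M * η ^ 3 * Γ₂ τ)
      refine h1.trans ?_
      linarith
    have hexp : 𝔼 τ, Γ₂ τ
        ≤ 32 * n ^ 3 * ((∑ j, ‖T j zs‖ ^ 2) / n ^ 2 + L ^ 2 * ‖z - zs‖ ^ 2) := by
      have h1 : ∀ θ, 0 ≤ θ → θ ≤ 1 → ∀ i ∈ Finset.range (2 * n), 𝔼 τ, p θ τ i ^ 2
          ≤ 8 * ∑ j, ‖T j zs‖ ^ 2 + 8 * n ^ 2 * (L * ‖z - zs‖) ^ 2 := fun θ h0 h1 i hi =>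
        expect_norm_sq_flipFlopPartial_le _ (fun j => T j zs) hzero
          (fun j => (hL j).norm_sub_le z zs) h0 h1 (Finset.mem_range.1 hi)
      rw [hΓ₂, Finset.expect_sum_comm]
      simp only [Finset.expect_add_distrib]
      refine (Finset.sum_le_sum fun i hi => add_le_add
        (h1 (1 / 2) (by norm_num) (by norm_num) i hi) (h1 0 le_rfl zero_le_one i hi)).trans
        (le_of_eq ?_)
      simp only [Finset.sum_const, Finset.card_range, nsmul_eq_mul]
      push_cast
      field_simp
      ring
    refine (Finset.expect_le_expect fun τ _ => hrsq τ).trans ?_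
    rw [← Finset.mul_expect]
    refine (mul_le_mul_of_nonneg_left hexp (by positivity)).trans (le_of_eq ?_)
    ring

end Epoch

/-! ### Iteration of the one-epoch estimate. -/

section Convergence

variable {d₁ d₂ n : ℕ} [NeZero n] {T : Fin n → Z d₁ d₂ → Z d₁ d₂}

lemma norm_add_sq_le_of_pos {E : Type*} [NormedAddCommGroup E] (u r : E) {x : ℝ} (hx : 0 < x) :
    ‖u + r‖ ^ 2 ≤ (1 + x) * ‖u‖ ^ 2 + (1 + 1 / x) * ‖r‖ ^ 2 := by
  have h1 := pow_le_pow_left₀ (norm_nonneg _) (norm_add_le u r) 2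
  have h2 : 0 ≤ (x * ‖u‖ - ‖r‖) ^ 2 / x := by positivity
  have h3 : (x * ‖u‖ - ‖r‖) ^ 2 / x = x * ‖u‖ ^ 2 - 2 * ‖u‖ * ‖r‖ + 1 / x * ‖r‖ ^ 2 := by
    field_simp
    ring
  linarith

/-- A perturbed contraction stays in a ball and contracts in mean square up to noise. -/
lemma perturbed_contraction {E : Type*} [NormedAddCommGroup E] {Ω : Type*} [Fintype Ω] [Nonempty Ω]
    {g : Ω → E} {u zs : E} {d μ h R C₁ C₂ V ℓ : ℝ} (hμ : 0 < μ) (hh : 0 < h) (hμh : μ * h ≤ 1)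
    (hdR : d ≤ R) (hu : ‖u - zs‖ ≤ (1 - μ * h / 2) * d)
    (hC₁h : 2 * C₁ * h ^ 2 ≤ μ * R) (hC₂h : 16 * C₂ * ℓ * h ^ 4 ≤ μ ^ 2)
    (hr : ∀ ω, ‖g ω - u‖ ≤ C₁ * h ^ 3)
    (hrE : 𝔼 ω, ‖g ω - u‖ ^ 2 ≤ C₂ * h ^ 6 * (V + ℓ * d ^ 2)) :
    (∀ ω, ‖g ω - zs‖ ≤ R) ∧
      𝔼 ω, ‖g ω - zs‖ ^ 2 ≤ (1 - μ * h / 4) * d ^ 2 + 4 * C₂ / μ * h ^ 5 * V := by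
  have hsplit : ∀ ω, g ω - zs = (u - zs) + (g ω - u) := fun ω => by abel
  refine ⟨fun ω => ?_, ?_⟩
  · rw [hsplit]
    refine (norm_add_le _ _).trans ((add_le_add hu (hr ω)).trans ?_)
    have h1 : (1 - μ * h / 2) * d ≤ (1 - μ * h / 2) * R :=
      mul_le_mul_of_nonneg_left hdR (by linarith)
    have h2 := mul_le_mul_of_nonneg_right hC₁h hh.le
    linarith
  -- Young's inequality with `x` equal to the contraction gap: one factor `1 - x` survives, and `1 +
  -- 1/x ≤ 4/(μh)` costs the noise one power of `h`.
  · set x := μ * h / 2 with hx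
    have hx0 : 0 < x := by positivity
    have h1 : 𝔼 ω, ‖g ω - zs‖ ^ 2
        ≤ (1 + x) * ‖u - zs‖ ^ 2 + (1 + 1 / x) * 𝔼 ω, ‖g ω - u‖ ^ 2 := by
      rw [Finset.mul_expect, ← Fintype.expect_const (ι := Ω) ((1 + x) * ‖u - zs‖ ^ 2),
        ← Finset.expect_add_distrib]
      refine Finset.expect_le_expect fun ω _ => ?_
      rw [hsplit]
      exact norm_add_sq_le_of_pos _ _ hx0
    have h2 : (1 + x) * ‖u - zs‖ ^ 2 ≤ (1 - x) * d ^ 2 := by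
      have h3 := pow_le_pow_left₀ (norm_nonneg _) hu 2
      have h4 := mul_le_mul_of_nonneg_left h3 (show 0 ≤ 1 + x by linarith)
      have h5 : (1 + x) * (1 - x) ^ 2 ≤ 1 - x := by
        nlinarith [mul_nonneg (sq_nonneg x) (show 0 ≤ 1 - x by linarith)]
      have h6 := mul_le_mul_of_nonneg_right h5 (sq_nonneg d)
      linarith
    have h7 : 1 + 1 / x ≤ 4 / (μ * h) := by
      have : 4 / (μ * h) = 2 / x := by rw [hx]; field_simp; norm_num
      rw [this, le_div_iff₀ hx0, add_mul, one_div, inv_mul_cancel₀ hx0.ne']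
      linarith
    have h8 : (1 + 1 / x) * 𝔼 ω, ‖g ω - u‖ ^ 2
        ≤ 4 / (μ * h) * (C₂ * h ^ 6 * (V + ℓ * d ^ 2)) :=
      mul_le_mul h7 hrE (Finset.expect_nonneg fun _ _ => by positivity) (by positivity)
    have h9 : 4 / (μ * h) * (C₂ * h ^ 6 * (V + ℓ * d ^ 2))
        = 4 * C₂ / μ * h ^ 5 * V + (16 * C₂ * ℓ * h ^ 4) * (h / (4 * μ) * d ^ 2) := by
      field_simp
      ring
    -- The noise proportional to `d²` uses up at most `μh/4`, half of the contraction.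
    have h10 := mul_le_mul_of_nonneg_right hC₂h (show 0 ≤ h / (4 * μ) * d ^ 2 by positivity)
    have h12 : (1 - x) * d ^ 2 = (1 - μ * h / 2) * d ^ 2 := by rw [hx]
    have h11 : μ ^ 2 * (h / (4 * μ) * d ^ 2) = μ * h / 4 * d ^ 2 := by
      field_simp
    linarith

/-- Separating the last permutation from the earlier ones plays the role of conditioning on the
past. -/
lemma meanSqDist_succ (α β : ℕ → ℝ) (z₀ : Z d₁ d₂) (K : ℕ) (zs : Z d₁ d₂) :
    meanSqDist T α β z₀ (K + 1) zs
      = 𝔼 ρ : Fin K → Equiv.Perm (Fin n), 𝔼 τ : Equiv.Perm (Fin n),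
          ‖epoch T (α K) (β K) τ (iterate T α β z₀ K ρ) - zs‖ ^ 2 := by
  rw [meanSqDist, Finset.expect_comm, ← Finset.expect_product', Finset.univ_product_univ]
  refine (Fintype.expect_equiv (Fin.snocEquiv fun _ => Equiv.Perm (Fin n)) _ _ ?_).symm
  rintro ⟨τ, ρ⟩
  simp [iterate, Fin.snocEquiv]

/-- A one-epoch estimate on an invariant ball iterates. -/
lemma meanSqDist_le {α β : ℝ} {z₀ zs : Z d₁ d₂} {R a b : ℝ} (ha : 0 < a) (ha' : a ≤ 1) (hb : 0 ≤ b)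
    (hz₀ : ‖z₀ - zs‖ ≤ R)
    (hinv : ∀ z, ‖z - zs‖ ≤ R → ∀ τ, ‖epoch T α β τ z - zs‖ ≤ R)
    (hstep : ∀ z, ‖z - zs‖ ≤ R →
      𝔼 τ, ‖epoch T α β τ z - zs‖ ^ 2 ≤ (1 - a) * ‖z - zs‖ ^ 2 + b) (K : ℕ) :
    meanSqDist T (fun _ => α) (fun _ => β) z₀ K zs
      ≤ Real.exp (-(a * K)) * ‖z₀ - zs‖ ^ 2 + b / a := by
  have hball : ∀ K (ρ : Fin K → Equiv.Perm (Fin n)),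
      ‖iterate T (fun _ => α) (fun _ => β) z₀ K ρ - zs‖ ≤ R := by
    intro K
    induction K with
    | zero => exact fun _ => hz₀
    | succ K ih => exact fun ρ => hinv _ (ih _) _
  have hpow : meanSqDist T (fun _ => α) (fun _ => β) z₀ K zs
      ≤ (1 - a) ^ K * ‖z₀ - zs‖ ^ 2 + b / a := by
    induction K with
    | zero =>
      have : 0 ≤ b / a := by positivity
      simpa [meanSqDist, iterate] using this
    | succ K ih =>
      rw [meanSqDist_succ]
      refine (Finset.expect_le_expect fun ρ _ => hstep _ (hball K ρ)).trans ?_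
      rw [Finset.expect_add_distrib, Fintype.expect_const, ← Finset.mul_expect]
      have h1 := mul_le_mul_of_nonneg_left ih (sub_nonneg.2 ha')
      have h2 : (1 - a) * (b / a) + b = b / a := by field_simp; ring
      rw [meanSqDist] at h1
      rw [pow_succ]
      linarith
  refine hpow.trans (add_le_add_left (mul_le_mul_of_nonneg_right ?_ (sq_nonneg _)) _)
  have h1 : 1 - a ≤ Real.exp (-a) := Real.one_sub_le_exp_neg a
  refine (pow_le_pow_left₀ (sub_nonneg.2 ha') h1 K).trans (le_of_eq ?_)
  rw [← Real.exp_nat_mul]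
  congr 1
  ring

/-- All the stepsize restrictions hold for small positive stepsizes. -/
lemma exists_pos_forall_mul_pow_le (μ : ℝ) (hμ : 0 < μ) (L R C₁ C₂ ℓ : ℝ) (hR : 0 < R) :
    ∃ h₀ : ℝ, 0 < h₀ ∧ ∀ h, 0 < h → h ≤ h₀ →
      8 * h * L ≤ 1 ∧ 3 * L ^ 2 * h ≤ μ ∧ μ * h ≤ 1 ∧ 2 * C₁ * h ^ 2 ≤ μ * R ∧
        16 * C₂ * ℓ * h ^ 4 ≤ μ ^ 2 := by
  have key : ∀ (g : ℝ → ℝ) (B : ℝ), Continuous g → g 0 = 0 → 0 < B →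
      ∀ᶠ h in nhds (0 : ℝ), g h ≤ B := fun g B hg h0 hB =>
    (hg.tendsto' 0 0 h0).eventually (ge_mem_nhds hB)
  have hev := (key (fun h => 8 * h * L) 1 (by fun_prop) (by simp) one_pos).and
    ((key (fun h => 3 * L ^ 2 * h) μ (by fun_prop) (by simp) hμ).and
    ((key (fun h => μ * h) 1 (by fun_prop) (by simp) one_pos).and
    ((key (fun h => 2 * C₁ * h ^ 2) (μ * R) (by fun_prop) (by simp) (by positivity)).and
    (key (fun h => 16 * C₂ * ℓ * h ^ 4) (μ ^ 2) (by fun_prop) (by simp) (by positivity)))))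
  obtain ⟨ε, hε, h⟩ := Metric.eventually_nhds_iff.1 hev
  refine ⟨ε / 2, by positivity, fun x hx hx' => h ?_⟩
  rw [Real.dist_eq, sub_zero, abs_of_pos hx]
  linarith

/-- Convergence of flip-flop extragradient with anchoring at a fixed effective stepsize. -/
lemma exists_meanSqDist_le (μ : ℝ) (hμ : 0 < μ) (L M σ D : ℝ≥0) :
    ∃ h₀ : ℝ, 0 < h₀ ∧ ∃ C : ℝ, 0 ≤ C ∧ ∀ h, 0 < h → h ≤ h₀ →
      ∀ (n : ℕ) [NeZero n] (d₁ d₂ : ℕ) (T : Fin n → Z d₁ d₂ → Z d₁ d₂) (z₀ zs : Z d₁ d₂) (K : ℕ),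
        (∀ i, LipschitzWith L (T i)) → (∀ i, Differentiable ℝ (T i)) →
        (∀ i, LipschitzWith M (fderiv ℝ (T i))) →
        (∀ z, μ * ‖z - zs‖ ^ 2 ≤ inner ℝ (avg (fun j => T j z)) (z - zs)) →
        ∑ j, T j zs = 0 → ‖z₀ - zs‖ ≤ D → ∑ j, ‖T j zs‖ ^ 2 ≤ n * (σ : ℝ) ^ 2 →
        meanSqDist T (fun _ => h / n / 2) (fun _ => h / n) z₀ K zs
          ≤ Real.exp (-(μ * h / 4 * K)) * ‖z₀ - zs‖ ^ 2
            + C * h ^ 4 * ((∑ j, ‖T j zs‖ ^ 2) / n ^ 2) := by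
  -- The `+ 1` keeps the radius positive when `D = 0`; otherwise `2 * C₁ * h ^ 2 ≤ μ * R` could fail
  -- for every positive `h`.
  set R : ℝ := D + 1 with hR
  have hR0 : 0 < R := by positivity
  set B : ℝ := 2 * (σ + L * R) with hB
  have hB0 : 0 ≤ B := by positivity
  set C₁ : ℝ := 8 * L ^ 2 * B + 6 * M * B ^ 2 with hC₁
  set C₂ : ℝ := 32 * (32 * L ^ 4 + 18 * M ^ 2 * B ^ 2) with hC₂
  have hC₁0 : 0 ≤ C₁ := by positivity
  have hC₂0 : 0 ≤ C₂ := by positivity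
  obtain ⟨h₀, hh₀, hsmall⟩ := exists_pos_forall_mul_pow_le μ hμ L R C₁ C₂ (L ^ 2) hR0
  -- This is the noise `4C₂h⁵/μ` per epoch divided by the gap `μh/4`, without `h⁴`.
  refine ⟨h₀, hh₀, 16 * C₂ / μ ^ 2, by positivity, ?_⟩
  intro h hh hhh n _ d₁ d₂ T z₀ zs K hL hd hM hmono hzero hz₀ hvar
  obtain ⟨e1, e2, e3, e4, e5⟩ := hsmall h hh hhh
  have hn : (0 : ℝ) < n := Nat.cast_pos.2 (NeZero.pos n)
  have hnh : (n : ℝ) * (h / n) = h := by field_simp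
  have hone : ∀ z, ‖z - zs‖ ≤ R → (∀ τ, ‖epoch T (h / n / 2) (h / n) τ z - zs‖ ≤ R) ∧
      𝔼 τ, ‖epoch T (h / n / 2) (h / n) τ z - zs‖ ^ 2
        ≤ (1 - μ * h / 4) * ‖z - zs‖ ^ 2
          + 4 * C₂ / μ * h ^ 5 * ((∑ j, ‖T j zs‖ ^ 2) / n ^ 2) := by
    intro z hz
    obtain ⟨hr, hrE⟩ := epoch_remainder_bounds (η := h / n) (by positivity) σ.2
      (by rw [hnh]; exact e1) hL hd hM hzero hz hvar hB
    rw [hnh] at hr hrE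
    exact perturbed_contraction hμ hh e3 hz
      (norm_secondOrderStep_sub_le hh.le e2 e3 hL hzero (hmono z)) e4 e5 hr hrE
  refine (meanSqDist_le (a := μ * h / 4) (R := R) (by positivity) (by linarith) (by positivity)
    (hz₀.trans (by linarith)) (fun z hz => (hone z hz).1) (fun z hz => (hone z hz).2) K).trans
    (le_of_eq ?_)
  congr 1
  field_simp
  ring

end Convergence

/-! ### Zeros of strongly monotone operators; minimality along rays. -/

section Zero

/-- A Lipschitz strongly monotone operator on a Hilbert space has a zero. -/
lemma exists_zero_of_strongly_monotone {E : Type*} [NormedAddCommGroup E] [InnerProductSpace ℝ E]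
    [CompleteSpace E] {F : E → E} {μ : ℝ} {L : ℝ≥0} (hμ : 0 < μ) (hL : LipschitzWith L F)
    (hF : ∀ z w, μ * ‖z - w‖ ^ 2 ≤ inner ℝ (F z - F w) (z - w)) : ∃ z, F z = 0 := by
  have hpos : 0 < (L : ℝ) ^ 2 + μ ^ 2 := by positivity
  -- With this step `z - h F z` contracts squared distances by `1 - 2μh + L²h² ≤ 1 - μh`. The `μ²`
  -- in the denominator ensures `μh ≤ 1` and covers `L = 0`.
  set h : ℝ := μ / (L ^ 2 + μ ^ 2) with hh
  have hh0 : 0 < h := by positivity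
  have hq : (L : ℝ) ^ 2 * h ^ 2 ≤ μ * h := by
    have h1 : (L ^ 2 + μ ^ 2) * h = μ := by rw [hh]; field_simp
    nlinarith [mul_nonneg (sq_nonneg μ) (sq_nonneg h)]
  have hq0 : 0 ≤ 1 - μ * h := by
    have h1 : (L ^ 2 + μ ^ 2) * h = μ := by rw [hh]; field_simp
    have h2 : 1 - μ * h = L ^ 2 / (L ^ 2 + μ ^ 2) := by rw [hh]; field_simp; ring
    rw [h2]
    positivity
  have hlt : Real.toNNReal (Real.sqrt (1 - μ * h)) < 1 := by
    rw [Real.toNNReal_lt_one, Real.sqrt_lt' one_pos]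
    nlinarith [mul_pos hμ hh0]
  have hcontr : ContractingWith (Real.toNNReal (Real.sqrt (1 - μ * h))) (fun z => z - h • F z) := by
    refine ⟨hlt, LipschitzWith.of_dist_le_mul fun z w => ?_⟩
    rw [Real.coe_toNNReal _ (Real.sqrt_nonneg _), dist_eq_norm, dist_eq_norm]
    refine le_of_sq_le_sq ?_ (by positivity)
    rw [mul_pow, Real.sq_sqrt hq0]
    have h1 : z - h • F z - (w - h • F w) = (z - w) - h • (F z - F w) := by module
    rw [h1, norm_sub_sq_real, real_inner_smul_right, norm_smul, Real.norm_of_nonneg hh0.le,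
      real_inner_comm]
    have h2 := mul_le_mul_of_nonneg_left (hF z w) hh0.le
    have h3 : (h * ‖F z - F w‖) ^ 2 ≤ (h * (L * ‖z - w‖)) ^ 2 :=
      pow_le_pow_left₀ (by positivity)
        (mul_le_mul_of_nonneg_left (hL.norm_sub_le z w) hh0.le) 2
    have h4 := mul_le_mul_of_nonneg_right hq (sq_nonneg ‖z - w‖)
    linarith
  refine ⟨hcontr.fixedPoint _, ?_⟩
  have hfix : _ - h • F _ = _ := hcontr.fixedPoint_isFixedPt
  rw [sub_eq_self, smul_eq_zero] at hfix
  exact hfix.resolve_left hh0.ne'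

/-- A function that does not decrease along rays from `a` is minimal at `a`. -/
lemma le_of_fderiv_apply_sub_nonneg {E : Type*} [NormedAddCommGroup E] [NormedSpace ℝ E]
    {φ : E → ℝ} (hφ : Differentiable ℝ φ) (a : E) (h : ∀ x, 0 ≤ fderiv ℝ φ x (x - a)) (x : E) :
    φ a ≤ φ x := by
  have hderiv : ∀ t : ℝ, HasDerivAt (fun t : ℝ => φ (a + t • (x - a)))
      (fderiv ℝ φ (a + t • (x - a)) (x - a)) t := by
    intro t
    have h1 : HasDerivAt (fun t : ℝ => a + t • (x - a)) (x - a) t := by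
      simpa using ((hasDerivAt_id t).smul_const (x - a)).const_add a
    exact (hφ _).hasFDerivAt.comp_hasDerivAt t h1
  have hmono : MonotoneOn (fun t : ℝ => φ (a + t • (x - a))) (Set.Icc 0 1) := by
    refine monotoneOn_of_deriv_nonneg (convex_Icc 0 1)
      (fun t _ => (hderiv t).continuousAt.continuousWithinAt)
      (fun t _ => (hderiv t).differentiableAt.differentiableWithinAt) fun t ht => ?_
    rw [interior_Icc] at ht
    rw [(hderiv t).deriv]
    have h2 := h (a + t • (x - a))
    rw [add_sub_cancel_left, map_smul, smul_eq_mul] at h2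
    exact nonneg_of_mul_nonneg_right h2 ht.1
  simpa using hmono (Set.left_mem_Icc.2 zero_le_one) (Set.right_mem_Icc.2 zero_le_one) zero_le_one

end Zero

/-! ### Saddle points and zeros of the saddle gradient. -/

section SaddlePoint

variable {d₁ d₂ : ℕ}

lemma differentiable_comp_pair_left {g : Z d₁ d₂ → ℝ} (hg : Differentiable ℝ g)
    (y : EuclideanSpace ℝ (Fin d₂)) : Differentiable ℝ fun x => g (pair x y) :=
  hg.comp ((WithLp.prodContinuousLinearEquiv 2 ℝ (EuclideanSpace ℝ (Fin d₁))
    (EuclideanSpace ℝ (Fin d₂))).symm.differentiable.comp (differentiable_id.prodMk (differentiable_const y)))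

lemma differentiable_comp_pair_right {g : Z d₁ d₂ → ℝ} (hg : Differentiable ℝ g)
    (x : EuclideanSpace ℝ (Fin d₁)) : Differentiable ℝ fun y => g (pair x y) :=
  hg.comp ((WithLp.prodContinuousLinearEquiv 2 ℝ (EuclideanSpace ℝ (Fin d₁))
    (EuclideanSpace ℝ (Fin d₂))).symm.differentiable.comp ((differentiable_const x).prodMk differentiable_id))

lemma gradient_average {E : Type*} [NormedAddCommGroup E] [InnerProductSpace ℝ E]
    [CompleteSpace E] {n : ℕ} {φ : Fin n → E → ℝ} (hφ : ∀ i, Differentiable ℝ (φ i)) (x : E) :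
    gradient (fun x => (1 / (n : ℝ)) * ∑ i, φ i x) x
      = (1 / (n : ℝ)) • ∑ i, gradient (φ i) x := by
  simp only [gradient]
  rw [fderiv_const_mul (DifferentiableAt.fun_sum fun i _ => hφ i x),
    fderiv_fun_sum fun i _ => hφ i x]
  simp

lemma saddleGrad_objective {n : ℕ} {f : Fin n → Z d₁ d₂ → ℝ} (hf : ∀ i, Differentiable ℝ (f i))
    (z : Z d₁ d₂) : saddleGrad (objective f) z = avg (fun i => saddleGrad (f i) z) := by
  have h1 := gradient_average (fun i => differentiable_comp_pair_left (hf i) z.snd) z.fst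
  have h2 := gradient_average (fun i => differentiable_comp_pair_right (hf i) z.fst) z.snd
  have h3 : ∀ u : Fin n → Z d₁ d₂, avg u = pair ((1 / (n : ℝ)) • ∑ i, (u i).fst)
      ((1 / (n : ℝ)) • ∑ i, (u i).snd) := by
    intro u
    rw [avg, pair]
    refine (WithLp.equiv 2 _).injective (Prod.ext ?_ ?_)
    · simp [WithLp.ofLp_sum, Prod.fst_sum]
    · simp [WithLp.ofLp_sum, Prod.snd_sum]
  rw [h3]
  simp only [saddleGrad, objective]
  rw [h1, h2]
  simp [Finset.sum_neg_distrib]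

lemma differentiable_objective {n : ℕ} {f : Fin n → Z d₁ d₂ → ℝ}
    (hf : ∀ i, Differentiable ℝ (f i)) : Differentiable ℝ (objective f) := by
  unfold objective
  fun_prop

/-- Zeros of a monotone saddle gradient are saddle points. -/
lemma isSaddlePoint_of_saddleGrad_eq_zero {g : Z d₁ d₂ → ℝ} (hg : Differentiable ℝ g)
    (hmono : ∀ z w, 0 ≤ inner ℝ (saddleGrad g z - saddleGrad g w) (z - w)) {zs : Z d₁ d₂}
    (hzs : saddleGrad g zs = 0) : IsSaddlePoint g zs := by
  -- At points that share one block with `zs`, the inner product involves only the other partial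
  -- gradient, so monotonicity becomes growth along rays in that block.
  have hmono' : ∀ z, 0 ≤ inner ℝ (saddleGrad g z) (z - zs) := fun z => by
    simpa [hzs] using hmono z zs
  intro x y
  constructor
  · refine neg_le_neg_iff.1 (le_of_fderiv_apply_sub_nonneg (φ := fun y => -g (pair zs.fst y))
      (differentiable_comp_pair_right hg zs.fst).neg zs.snd (fun y => ?_) y)
    have h1 := hmono' (pair zs.fst y)
    rw [WithLp.prod_inner_apply] at h1
    simp only [saddleGrad, WithLp.ofLp_sub, Prod.fst_sub, Prod.snd_sub, inner_neg_left,
      inner_gradient_left] at h1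
    rw [fderiv_fun_neg]
    simpa using h1
  · refine le_of_fderiv_apply_sub_nonneg (φ := fun x => g (pair x zs.snd))
      (differentiable_comp_pair_left hg zs.snd) zs.fst (fun x => ?_) x
    have h1 := hmono' (pair x zs.snd)
    rw [WithLp.prod_inner_apply] at h1
    simp only [saddleGrad, WithLp.ofLp_sub, Prod.fst_sub, Prod.snd_sub,
      inner_gradient_left] at h1
    simpa using h1

lemma saddleGrad_eq_zero_of_isSaddlePoint {g : Z d₁ d₂ → ℝ} {zs : Z d₁ d₂}
    (h : IsSaddlePoint g zs) : saddleGrad g zs = 0 := by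
  have h1 : IsLocalMin (fun x => g (pair x zs.snd)) zs.fst :=
    Filter.Eventually.of_forall fun x => (h x zs.snd).2
  have h2 : IsLocalMax (fun y => g (pair zs.fst y)) zs.snd :=
    Filter.Eventually.of_forall fun y => (h zs.fst y).1
  simp only [saddleGrad, gradient, h1.fderiv_eq_zero, h2.fderiv_eq_zero, map_zero, neg_zero]
  rfl

end SaddlePoint

/-! ### Choice of the stepsize and conclusion. -/

/-- If `n` or `K` is at least 2, the logarithm is at least `(log 2)/4 > 1/8`. This yields `1 ≤ 4096
l⁴`, as `8⁴ = 4096`, and lets `1/(nK⁴)` be absorbed into the error term. -/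
lemma log_rpow_mul_pos_or {n K : ℕ} (hn : 1 ≤ n) (hK : 1 ≤ K) :
    1 / 8 ≤ Real.log ((n : ℝ) ^ (1 / 4 : ℝ) * K) ∨ (n = 1 ∧ K = 1) := by
  have hn0 : (0 : ℝ) < n := by exact_mod_cast hn
  have hK0 : (0 : ℝ) < K := by exact_mod_cast hK
  rw [Real.log_mul (by positivity) hK0.ne', Real.log_rpow hn0]
  have h1 : 0 ≤ Real.log n := Real.log_natCast_nonneg n
  have h2 : 0 ≤ Real.log K := Real.log_natCast_nonneg K
  have h3 := Real.log_two_gt_d9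
  have h4 : ∀ m : ℕ, 2 ≤ m → Real.log 2 ≤ Real.log m := fun m hm =>
    Real.log_le_log two_pos (by exact_mod_cast hm)
  by_cases hn2 : 2 ≤ n
  · left; linarith [h4 n hn2]
  by_cases hK2 : 2 ≤ K
  · left; linarith [h4 K hK2]
  · right; omega

/-- The stepsize `h = n η` balancing the contraction against the fourth-order noise. -/
lemma exists_stepsize (μ : ℝ) (hμ : 0 < μ) (h₀ : ℝ) (hh₀ : 0 < h₀) {n K : ℕ} (hn : 1 ≤ n)
    (hK : 1 ≤ K) :
    ∃ h, 0 < h ∧ h ≤ h₀ ∧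
      (h ^ 4 ≤ (16 / μ) ^ 4 * (Real.log ((n : ℝ) ^ (1 / 4 : ℝ) * K) ^ 4 / (K : ℝ) ^ 4) ∨ n = 1) ∧
      Real.exp (-(μ * h / 4 * K)) ≤ Real.exp (-(μ * h₀ / 4 * K))
        + 4096 * (Real.log ((n : ℝ) ^ (1 / 4 : ℝ) * K) ^ 4 / (n * (K : ℝ) ^ 4)) := by
  have hn0 : (0 : ℝ) < n := by exact_mod_cast hn
  have hK0 : (0 : ℝ) < K := by exact_mod_cast hK
  set l := Real.log ((n : ℝ) ^ (1 / 4 : ℝ) * K) with hl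
  have hrhs : 0 ≤ 4096 * (l ^ 4 / (n * (K : ℝ) ^ 4)) := by
    have : 0 ≤ l ^ 4 := Even.pow_nonneg (by decide) l
    positivity
  rcases log_rpow_mul_pos_or hn hK with hl8 | ⟨rfl, rfl⟩
  · rw [← hl] at hl8
    have hl0 : 0 < l := by linarith
    have hpow : (16 / μ) ^ 4 * (l ^ 4 / (K : ℝ) ^ 4) = (16 * l / (μ * K)) ^ 4 := by
      field_simp
    rcases le_total (16 * l / (μ * K)) h₀ with hcase | hcase
    -- This `h` makes the exponent `-4l`, so the exponential equals `1/(nK⁴)`.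
    · refine ⟨16 * l / (μ * K), by positivity, hcase, Or.inl hpow.ge, ?_⟩
      have h1 : μ * (16 * l / (μ * K)) / 4 * K = 4 * l := by field_simp; norm_num
      have h2 : Real.exp (4 * l) = n * (K : ℝ) ^ 4 := by
        have h3 : Real.exp (4 * l) = Real.exp l ^ 4 := by
          rw [← Real.exp_nat_mul]; norm_num
        rw [h3, hl, Real.exp_log (by positivity), mul_pow, ← Real.rpow_natCast, ← Real.rpow_mul
          hn0.le]
        norm_num
      rw [h1, Real.exp_neg, h2]
      have h4 : 1 ≤ 4096 * l ^ 4 := by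
        have := pow_le_pow_left₀ (by norm_num) hl8 4
        linarith
      have h5 : ((n : ℝ) * (K : ℝ) ^ 4)⁻¹ ≤ 4096 * (l ^ 4 / (n * (K : ℝ) ^ 4)) := by
        rw [← mul_div_assoc, ← one_div]
        exact div_le_div_of_nonneg_right h4 (by positivity)
      linarith [Real.exp_pos (-(μ * h₀ / 4 * K))]
    · refine ⟨h₀, hh₀, le_rfl, Or.inl ?_, by linarith⟩
      rw [hpow]
      exact pow_le_pow_left₀ hh₀.le hcase 4
  -- Here `n = K = 1` and `l = 0`, so the error term vanishes; the noise must vanish too, which `n =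
  -- 1` ensures.
  · exact ⟨h₀, hh₀, le_rfl, Or.inr rfl, by linarith⟩

end SEGFFA

theorem mainTheorem2 (μ : ℝ) (hμ : 0 < μ) (L M σ D : ℝ≥0) :
    ∃ c : ℝ, 0 < c ∧ ∃ C : ℝ, 0 < C ∧
      ∀ (n : ℕ) [NeZero n] (K : ℕ), 1 ≤ K →
        ∃ η : ℝ, 0 < η ∧
          ∀ (d₁ d₂ : ℕ) (f : Fin n → SEGFFA.Z d₁ d₂ → ℝ),
            (∀ i, SEGFFA.SmoothComponent L M (f i)) →
            SEGFFA.StronglyMonotone μ (SEGFFA.saddleGrad (SEGFFA.objective f)) →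
            (∃! zs, SEGFFA.IsSaddlePoint (SEGFFA.objective f) zs) ∧
            ∀ zs z₀ : SEGFFA.Z d₁ d₂,
              SEGFFA.IsSaddlePoint (SEGFFA.objective f) zs →
              ‖z₀ - zs‖ ≤ D →
              (1 / (n : ℝ)) * ∑ i, ‖SEGFFA.saddleGrad (f i) zs‖ ^ 2 ≤ (σ : ℝ) ^ 2 →
              SEGFFA.meanSqDist (fun i => SEGFFA.saddleGrad (f i))
                  (fun _ => η / 2) (fun _ => η) z₀ K zs
                ≤ Real.exp (-(1 / 2) * μ * (c / n) * n * K) * ‖z₀ - zs‖ ^ 2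
                  + C * (Real.log ((n : ℝ) ^ (1 / 4 : ℝ) * K) ^ 4 / (n * (K : ℝ) ^ 4)) := by
  obtain ⟨h₀, hh₀, C, hC, hconv⟩ := SEGFFA.exists_meanSqDist_le μ hμ L M σ D
  -- With `c = h₀/2` the required exponent is `-μh₀K/4`, the rate at the capped stepsize. In `C`,
  -- the first summand pays for the uncapped exponential, the second for the noise, and `+ 1` gives
  -- positivity.
  refine ⟨h₀ / 2, by positivity, 4096 * D ^ 2 + C * (16 / μ) ^ 4 * σ ^ 2 + 1, by positivity, ?_⟩
  intro n _ K hK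
  have hn1 : 1 ≤ n := NeZero.pos n
  have hn : (0 : ℝ) < n := by exact_mod_cast hn1
  obtain ⟨h, hh, hhh, hnoise, hexp⟩ := SEGFFA.exists_stepsize μ hμ h₀ hh₀ hn1 hK
  refine ⟨h / n, by positivity, ?_⟩
  intro d₁ d₂ f hf hmono
  have hdiff : ∀ i, Differentiable ℝ (f i) := fun i => (hf i).differentiable
  have hF := SEGFFA.saddleGrad_objective hdiff
  have hlip : LipschitzWith L (SEGFFA.saddleGrad (SEGFFA.objective f)) :=
    LipschitzWith.of_dist_le_mul fun z w => by
      rw [dist_eq_norm, dist_eq_norm, hF, hF]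
      have h1 : SEGFFA.avg (fun i => SEGFFA.saddleGrad (f i) z)
          - SEGFFA.avg (fun i => SEGFFA.saddleGrad (f i) w)
          = SEGFFA.avg (fun i => SEGFFA.saddleGrad (f i) z - SEGFFA.saddleGrad (f i) w) := by
        simp only [SEGFFA.avg, Finset.sum_sub_distrib, smul_sub]
      rw [h1]
      exact SEGFFA.norm_avg_le _ fun i => (hf i).lipschitz.norm_sub_le z w
  refine ⟨?_, ?_⟩
  · obtain ⟨zs, hzs⟩ := SEGFFA.exists_zero_of_strongly_monotone hμ hlip hmono
    refine ⟨zs, SEGFFA.isSaddlePoint_of_saddleGrad_eq_zero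
      (SEGFFA.differentiable_objective hdiff)
      (fun z w => (by positivity : 0 ≤ μ * ‖z - w‖ ^ 2).trans (hmono z w)) hzs, ?_⟩
    intro z hz
    have h1 := hmono z zs
    rw [SEGFFA.saddleGrad_eq_zero_of_isSaddlePoint hz, hzs, sub_zero, inner_zero_left] at h1
    have h2 : ‖z - zs‖ ^ 2 ≤ 0 := nonpos_of_mul_nonpos_right h1 hμ
    rw [← sub_eq_zero, ← norm_eq_zero]
    exact pow_eq_zero_iff two_ne_zero |>.1 (le_antisymm h2 (sq_nonneg _))
  · intro zs z₀ hzs hz₀ hvar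
    have hF0 := SEGFFA.saddleGrad_eq_zero_of_isSaddlePoint hzs
    have hzero : ∑ i, SEGFFA.saddleGrad (f i) zs = 0 := by
      rw [hF, SEGFFA.avg, smul_eq_zero] at hF0
      exact hF0.resolve_left (by positivity)
    have hvar' : ∑ i, ‖SEGFFA.saddleGrad (f i) zs‖ ^ 2 ≤ n * (σ : ℝ) ^ 2 := by
      rwa [one_div, inv_mul_le_iff₀ hn] at hvar
    have hmono' : ∀ z, μ * ‖z - zs‖ ^ 2
        ≤ inner ℝ (SEGFFA.avg (fun i => SEGFFA.saddleGrad (f i) z)) (z - zs) := fun z => by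
      have h1 := hmono z zs
      rwa [SEGFFA.saddleGrad_eq_zero_of_isSaddlePoint hzs, sub_zero, hF] at h1
    refine (hconv h hh hhh n d₁ d₂ _ z₀ zs K (fun i => (hf i).lipschitz)
      (fun i => (hf i).differentiable_saddleGrad) (fun i => (hf i).lipschitz_fderiv) hmono'
      hzero hz₀ hvar').trans ?_
    set l := Real.log ((n : ℝ) ^ (1 / 4 : ℝ) * K) with hl
    have hK0 : (0 : ℝ) < K := by exact_mod_cast hK
    have hl4 : 0 ≤ l ^ 4 := Even.pow_nonneg (by decide) l
    have hq : 0 ≤ l ^ 4 / (n * (K : ℝ) ^ 4) := by positivity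
    have hrate : -(1 / 2) * μ * (h₀ / 2 / n) * n * K = -(μ * h₀ / 4 * K) := by
      field_simp
      ring
    have h1 := mul_le_mul_of_nonneg_right hexp (sq_nonneg ‖z₀ - zs‖)
    have h2 : l ^ 4 / (n * (K : ℝ) ^ 4) * ‖z₀ - zs‖ ^ 2
        ≤ l ^ 4 / (n * (K : ℝ) ^ 4) * D ^ 2 :=
      mul_le_mul_of_nonneg_left (pow_le_pow_left₀ (norm_nonneg _) hz₀ 2) hq
    have h3 : C * h ^ 4 * ((∑ i, ‖SEGFFA.saddleGrad (f i) zs‖ ^ 2) / n ^ 2)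
        ≤ C * (16 / μ) ^ 4 * σ ^ 2 * (l ^ 4 / (n * (K : ℝ) ^ 4)) := by
      rcases hnoise with hnoise | rfl
      · have h4 : (∑ i, ‖SEGFFA.saddleGrad (f i) zs‖ ^ 2) / (n : ℝ) ^ 2 ≤ σ ^ 2 / n := by
          rw [div_le_div_iff₀ (by positivity) hn]
          have := mul_le_mul_of_nonneg_right hvar' hn.le
          linarith
        refine (mul_le_mul (mul_le_mul_of_nonneg_left hnoise hC) h4 (by positivity)
          (by positivity)).trans (le_of_eq ?_)
        field_simp
      -- A single component vanishes at the saddle point, so there is no noise.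
      · rw [Fin.sum_univ_one] at hzero
        rw [Fin.sum_univ_one, hzero]
        have : 0 ≤ C * (16 / μ) ^ 4 * σ ^ 2 * (l ^ 4 / ((1 : ℕ) * (K : ℝ) ^ 4)) := by positivity
        simpa using this
    rw [hrate]
    linarith
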